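/- **Lemma (Splitting Lemma).** Let $R$ be a commutative ring, let $S$ be an $R$-algebra that is finitely generated as an $R$-module, let $M$ be a right $S$-module, and let $N$ be a finitely presented right $S$-module. View right $S$-modules and $\operatorname{Hom}_S(M,N)$ as $R$-modules through the structure map $R\to S$. For an $R$-submodule $F\subseteq\operatorname{Hom}_S(M,N)$ and $\mathfrak p\in\operatorname{Spec}(R)$, let $\delta_{\mathfrak p}(F)\in\{0,1,2,\dots\}\cup\{\infty\}$ be the supremum of the integers $k\geq 0$ for which there is $f\in F^{\oplus k}\subseteq\operatorname{Hom}_S(M,N^{\oplus k})$ such that the localized map $f_{\mathfrak p}\colon M_{\mathfrak p}\to (N^{\oplus k})_{\mathfrak p}$ is split surjective over $S_{\mathfrak p}$, that is, has an $S_{\mathfrak p}$-linear right inverse. For $\mathfrak p\in X\subseteq\operatorname{Spec}(R)$, let $\dim_X(\mathfrak p)$ be the (possibly infinite) Krull dimension of the topological space $\{\mathfrak q\in X:\mathfrak p\subseteq\mathfrak q\}$, with the topology induced by the Zariski topology. For positive integers $m\geq t$ and $Y\subseteq X\subseteq\operatorname{Spec}(R)$, a map $f=(f_1,\dots,f_m)^{\top}\in\operatorname{Hom}_S(M,N^{\oplus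 m})$ is *$(t,X,Y)$-split* if $$\delta_{\mathfrak q}(Rf_1+\cdots+Rf_m)\ \geq\ \min\{m,\ t+\dim_X(\mathfrak q)\}\qquad\text{for every }\mathfrak q\in Y.$$ A subset $X\subseteq\operatorname{Spec}(R)$ is a *basic set for $R$* if $X$ is a Noetherian topological space and every $\mathfrak p\in\operatorname{Spec}(R)$ that is an intersection of members of $X$ belongs to $X$. Let $n,t$ be positive integers with $n\geq t+1$, let $X$ be a subset of $\operatorname{Supp}_R(N)$ that is a basic set for $R$, and let $f=(f_1,\dots,f_n)^{\top}\in\operatorname{Hom}_S(M,N^{\oplus n})$ be $(t,X,X)$-split. Then there exist $f'_1,\dots,f'_{n-1}\in Rf_1+\cdots+Rf_n$ such that $f'=(f'_1,\dots,f'_{n-1})^{\top}$ is $(t,X,X)$-split. -/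

import Mathlib

/-! Right `S`-modules are modules over `Sᵐᵒᵖ`; the compatibility `IsScalarTower R Sᵐᵒᵖ M` says
that the `R`-module structure of `M` is the one induced by the structure map `R → S`. -/

namespace SplitCapacity

open MulOpposite

section Localization

variable {R S M N : Type*} [CommRing R] [Ring S] [Algebra R S]
variable [AddCommGroup M] [Module R M] [Module Sᵐᵒᵖ M] [IsScalarTower R Sᵐᵒᵖ M]
variable [AddCommGroup N] [Module R N] [Module Sᵐᵒᵖ N] [IsScalarTower R Sᵐᵒᵖ N]
variable (T : Submonoid R)

theorem op_smul_comm (r : R) (a : S) (m : M) : op (r • a) • m = r • op a • m := by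
  rw [op_smul, smul_assoc]

theorem smul_op_comm (r : R) (a : S) (m : M) : op a • r • m = r • op a • m :=
  smul_comm _ _ _

/-- The right action of the localized ring `T⁻¹S` on `T⁻¹M`: `(m / v) · (a / u) = (m · a) / (u v)`. -/
instance rightSMul : SMul (LocalizedModule T S)ᵐᵒᵖ (LocalizedModule T M) where
  smul x y := LocalizedModule.liftOn (unop x)
    (fun p => LocalizedModule.liftOn y
      (fun q => LocalizedModule.mk (op p.1 • q.1) (p.2 * q.2)) (by
        rintro ⟨m, v⟩ ⟨m', v'⟩ ⟨d, hd⟩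
        refine LocalizedModule.mk_eq.mpr ⟨d, ?_⟩
        simp only [Submonoid.smul_def] at hd ⊢
        have key := congrArg (fun z => (p.2 : R) • op p.1 • z) hd
        simp only [smul_op_comm, smul_smul, Submonoid.coe_mul] at key ⊢
        convert key using 2 <;> ring)) (by
      rintro ⟨a, s⟩ ⟨a', s'⟩ ⟨c, hc⟩
      induction y with | _ m v
      simp only [LocalizedModule.liftOn_mk]
      refine LocalizedModule.mk_eq.mpr ⟨c, ?_⟩
      simp only [Submonoid.smul_def] at hc ⊢
      have key := congrArg (fun z => (v : R) • op z • m) hc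
      simp only [op_smul_comm, smul_smul, Submonoid.coe_mul] at key ⊢
      convert key using 2 <;> ring)

theorem op_mk_smul_mk (a : S) (u : T) (m : M) (v : T) :
    op (LocalizedModule.mk a u) • LocalizedModule.mk m v
      = LocalizedModule.mk (op a • m) (u * v) := rfl

/-- `T⁻¹M` is a right module over the localized ring `T⁻¹S`. -/
instance rightModule : Module (LocalizedModule T S)ᵐᵒᵖ (LocalizedModule T M) where
  one_smul y := by
    induction y with | _ m v
    have h : (1 : (LocalizedModule T S)ᵐᵒᵖ) = op (LocalizedModule.mk (1 : S) (1 : T)) := by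
      rw [← op_one, OreLocalization.one_def]
    rw [h, op_mk_smul_mk, op_one, one_smul, one_mul]
  mul_smul x x' y := by
    induction x using MulOpposite.rec' with | _ x
    induction x' using MulOpposite.rec' with | _ x'
    induction x with | _ a u
    induction x' with | _ a' u'
    induction y with | _ m v
    rw [← op_mul, LocalizedModule.mk_mul_mk, op_mk_smul_mk, op_mk_smul_mk, op_mk_smul_mk, op_mul,
      mul_smul, ← mul_assoc, mul_comm u']
  smul_zero x := by
    induction x using MulOpposite.rec' with | _ x
    induction x with | _ a u
    rw [← LocalizedModule.zero_mk (1 : T), op_mk_smul_mk, smul_zero, LocalizedModule.zero_mk,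
      LocalizedModule.zero_mk]
  smul_add x y y' := by
    induction x using MulOpposite.rec' with | _ x
    induction x with | _ a u
    induction y with | _ m v
    induction y' with | _ m' v'
    rw [LocalizedModule.mk_add_mk, op_mk_smul_mk, op_mk_smul_mk, op_mk_smul_mk,
      LocalizedModule.mk_add_mk]
    refine LocalizedModule.mk_eq.mpr ⟨1, ?_⟩
    simp only [Submonoid.smul_def, smul_add, smul_op_comm, smul_smul, Submonoid.coe_mul]
    congr 2 <;> ring
  add_smul x x' y := by
    induction x using MulOpposite.rec' with | _ x
    induction x' using MulOpposite.rec' with | _ x'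
    induction x with | _ a u
    induction x' with | _ a' u'
    induction y with | _ m v
    rw [← op_add, LocalizedModule.mk_add_mk, op_mk_smul_mk, op_mk_smul_mk, op_mk_smul_mk,
      LocalizedModule.mk_add_mk]
    refine LocalizedModule.mk_eq.mpr ⟨1, ?_⟩
    simp only [Submonoid.smul_def, op_add, add_smul, op_smul_comm, smul_add, smul_smul,
      Submonoid.coe_mul]
    congr 2 <;> ring
  zero_smul y := by
    induction y with | _ m v
    rw [← op_zero, ← LocalizedModule.zero_mk (1 : T), op_mk_smul_mk, op_zero, zero_smul,
      LocalizedModule.zero_mk]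

/-- The localization `T⁻¹f : T⁻¹M → T⁻¹N`, `m / v ↦ f m / v`, of a right `S`-linear map,
as a right `T⁻¹S`-linear map. -/
noncomputable def localizedMap (f : M →ₗ[Sᵐᵒᵖ] N) :
    LocalizedModule T M →ₗ[(LocalizedModule T S)ᵐᵒᵖ] LocalizedModule T N where
  toFun := LocalizedModule.map T (f.restrictScalars R)
  map_add' := map_add _
  map_smul' x y := by
    induction x using MulOpposite.rec' with | _ x
    induction x with | _ a u
    induction y with | _ m v
    simp [op_mk_smul_mk, LocalizedModule.map_mk]

theorem localizedMap_mk (f : M →ₗ[Sᵐᵒᵖ] N) (m : M) (v : T) :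
    localizedMap T f (LocalizedModule.mk m v) = LocalizedModule.mk (f m) v :=
  LocalizedModule.map_mk T (f.restrictScalars R) m v

end Localization

/-- A linear map is split surjective if it has a linear right inverse. -/
def IsSplitSurjective {A M N : Type*} [Ring A] [AddCommGroup M] [Module A M]
    [AddCommGroup N] [Module A N] (f : M →ₗ[A] N) : Prop :=
  ∃ g : N →ₗ[A] M, f ∘ₗ g = LinearMap.id

section Capacity

variable {R S M N : Type*} [CommRing R] [Ring S] [Algebra R S]
variable [AddCommGroup M] [Module R M] [Module Sᵐᵒᵖ M] [IsScalarTower R Sᵐᵒᵖ M]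
variable [AddCommGroup N] [Module R N] [Module Sᵐᵒᵖ N] [IsScalarTower R Sᵐᵒᵖ N]

/-- The local split capacity `δ_p(F)` of an `R`-submodule `F` of `Hom_S(M, N)`: the supremum of the
`t` such that some `(f_1, …, f_t) ∈ F^t`, seen as a map `M → N^t`, is split surjective over `S_p`
after localization at `p`. -/
noncomputable def delta (p : PrimeSpectrum R) (F : Submodule R (M →ₗ[Sᵐᵒᵖ] N)) : ℕ∞ :=
  sSup {k : ℕ∞ | ∃ t : ℕ, k = t ∧ ∃ f : Fin t → (M →ₗ[Sᵐᵒᵖ] N), (∀ i, f i ∈ F) ∧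
    IsSplitSurjective (localizedMap p.asIdeal.primeCompl (LinearMap.pi f))}

/-- `dim_X(p)`: the Krull dimension of the subspace `V(p) ∩ X` of `Spec R`. -/
noncomputable def dimAt (X : Set (PrimeSpectrum R)) (p : PrimeSpectrum R) : WithBot ℕ∞ :=
  topologicalKrullDim ↥(PrimeSpectrum.zeroLocus (p.asIdeal : Set R) ∩ X)

/-- `X` is a basic set for `R`: it is a Noetherian space, and it contains every prime that is an
intersection of members of `X`. -/
def IsBasicSet (X : Set (PrimeSpectrum R)) : Prop :=
  TopologicalSpace.NoetherianSpace ↥X ∧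
    ∀ p : PrimeSpectrum R,
      (∃ Y ⊆ X, p.asIdeal = ⨅ q ∈ Y, PrimeSpectrum.asIdeal q) → p ∈ X

/-- `f = (f_1, …, f_n)` is `(t, X, p)`-split:
`δ_p(R f_1 + ⋯ + R f_n) ≥ min {n, t + dim_X(p)}`. -/
def IsSplitAt (t : ℕ) (X : Set (PrimeSpectrum R)) (p : PrimeSpectrum R) {n : ℕ}
    (f : Fin n → (M →ₗ[Sᵐᵒᵖ] N)) : Prop :=
  min (n : WithBot ℕ∞) ((t : WithBot ℕ∞) + dimAt X p)
    ≤ ((delta p (Submodule.span R (Set.range f)) : ℕ∞) : WithBot ℕ∞)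

/-- `f` is `(t, X, Y)`-split: it is `(t, X, q)`-split for every `q ∈ Y`. -/
def IsSplitOn (t : ℕ) (X Y : Set (PrimeSpectrum R)) {n : ℕ}
    (f : Fin n → (M →ₗ[Sᵐᵒᵖ] N)) : Prop :=
  ∀ q ∈ Y, IsSplitAt t X q f

end Capacity

end SplitCapacity

namespace SplitCapacity

/-! ### Polynomial values avoiding finitely many primes -/

open MvPolynomial in
theorem algebraMap_eval {R A σ : Type*} [CommRing R] [CommRing A] [Algebra R A]
    (P : MvPolynomial σ R) (a : σ → R) :
    algebraMap R A (eval a P) = aeval (fun i => algebraMap R A (a i)) P := by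
  rw [← aeval_eq_eval]
  exact (aeval_algebraMap_apply A a P).symm

open MvPolynomial in
theorem eval_mem_iff_aeval_eq_zero {R σ : Type*} [CommRing R] (I : Ideal R)
    (P : MvPolynomial σ R) (a : σ → R) :
    eval a P ∈ I ↔ aeval (fun i => Ideal.Quotient.mk I (a i)) P = 0 := by
  rw [← Ideal.Quotient.eq_zero_iff_mem]
  exact iff_of_eq (congrArg (· = 0) (algebraMap_eval (A := R ⧸ I) P a))

theorem algebraMap_fractionRing_quotient_eq_zero_iff {R : Type*} [CommRing R] (p : Ideal R)
    [p.IsPrime] (r : R) : algebraMap R (FractionRing (R ⧸ p)) r = 0 ↔ r ∈ p := by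
  rw [IsScalarTower.algebraMap_apply R (R ⧸ p), FaithfulSMul.algebraMap_eq_zero_iff]
  exact Ideal.Quotient.eq_zero_iff_mem

open MvPolynomial in
/-- A polynomial with a nonzero value over the residue field at a prime `p` has a value outside
`p`. -/
theorem exists_eval_notMem_of_aeval_ne_zero {R σ : Type*} [CommRing R] (p : Ideal R) [p.IsPrime]
    (P : MvPolynomial σ R) (z : σ → FractionRing (R ⧸ p)) (hz : aeval z P ≠ 0) :
    ∃ b : σ → R, eval b P ∉ p := by
  rcases finite_or_infinite (R ⧸ p) with hA | hA
  -- A finite domain is its own fraction field, so the point `z` itself lifts to `R`. Over an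
  -- infinite domain, a polynomial vanishing at all points is zero.
  · have hsurj : Function.Surjective (algebraMap (R ⧸ p) (FractionRing (R ⧸ p))) :=
      IsFractionRing.surjective_iff_isField.mpr (Finite.isField_of_domain _)
    have hsurj' : Function.Surjective (algebraMap R (FractionRing (R ⧸ p))) := by
      rw [IsScalarTower.algebraMap_eq R (R ⧸ p)]
      exact hsurj.comp Ideal.Quotient.mk_surjective
    choose b hb using fun i => hsurj' (z i)
    refine ⟨b, fun h => hz ?_⟩
    rw [← funext hb, ← algebraMap_eval, algebraMap_fractionRing_quotient_eq_zero_iff]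
    exact h
  · by_contra! h
    have h0 : map (algebraMap R (R ⧸ p)) P = 0 := by
      refine MvPolynomial.funext fun b => ?_
      choose a ha using fun i => Ideal.Quotient.mk_surjective (b i)
      rw [map_zero, eval_map, ← aeval_def, ← funext ha, ← eval_mem_iff_aeval_eq_zero]
      exact h a
    apply hz
    rw [← aeval_map_algebraMap (R ⧸ p), h0, map_zero]

open MvPolynomial in
/-- Finitely many polynomials, each of which is nonzero at a prime `p` at some point over the
residue field, have values outside the respective primes at a common integral point. -/
theorem exists_forall_eval_notMem {R σ : Type*} [CommRing R] (Λ : Finset (PrimeSpectrum R))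
    (P : PrimeSpectrum R → MvPolynomial σ R)
    (hP : ∀ p ∈ Λ, ∃ z : σ → FractionRing (R ⧸ p.asIdeal), aeval z (P p) ≠ 0) :
    ∃ a : σ → R, ∀ p ∈ Λ, eval a (P p) ∉ p.asIdeal := by
  classical
  induction Λ using Finset.strongInduction with
  | H Λ ih =>
    rcases Λ.eq_empty_or_nonempty with rfl | hne
    · exact ⟨0, by simp⟩
    -- By minimality `q` contains none of the other primes, so some `r ∉ q` lies in all of them.
    obtain ⟨q, hq, hmin⟩ := Λ.exists_minimal hne
    obtain ⟨a, ha⟩ := ih (Λ.erase q) (Finset.erase_ssubset hq)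
      fun p hp => hP p (Finset.mem_of_mem_erase hp)
    obtain ⟨r, hr, hrq⟩ : ∃ r ∈ (Λ.erase q).inf PrimeSpectrum.asIdeal, r ∉ q.asIdeal := by
      by_contra! h
      obtain ⟨p, hp, hpq⟩ := (Ideal.IsPrime.inf_le' q.2).mp h
      obtain ⟨hne', hp⟩ := Finset.mem_erase.mp hp
      exact hne' (le_antisymm hpq (hmin hp hpq))
    have hr : ∀ p ∈ Λ.erase q, r ∈ p.asIdeal :=
      fun p hp => (Finset.inf_le (f := PrimeSpectrum.asIdeal) hp) hr
    obtain ⟨z, hz⟩ := hP q hq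
    let K := FractionRing (R ⧸ q.asIdeal)
    have hr0 : algebraMap R K r ≠ 0 := by
      rwa [Ne, algebraMap_fractionRing_quotient_eq_zero_iff]
    -- Moving `a` to `a + r b` changes nothing modulo the other primes. As `r` is invertible in the
    -- residue field at `q`, the point `z` is still reached by this substitution.
    obtain ⟨b, hb⟩ := exists_eval_notMem_of_aeval_ne_zero q.asIdeal
      (bind₁ (fun i => C (a i) + C r * X i) (P q))
      (fun i => (z i - algebraMap R K (a i)) / algebraMap R K r) (by
        rw [aeval_bind₁]
        convert hz using 3
        funext i
        simp only [map_add, map_mul, algHom_C, aeval_X]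
        change algebraMap R K (a i) +
          algebraMap R K r * ((z i - algebraMap R K (a i)) / algebraMap R K r) = z i
        rw [mul_div_cancel₀ _ hr0, add_sub_cancel])
    have hb' : eval b (bind₁ (fun i => C (a i) + C r * X i) (P q)) =
        eval (fun i => a i + r * b i) (P q) := by
      rw [← aeval_eq_eval, ← aeval_eq_eval, aeval_bind₁]
      simp
    refine ⟨fun i => a i + r * b i, fun p hp => ?_⟩
    by_cases hpq : p = q
    · subst hpq
      rwa [hb'] at hb
    · have hp' := Finset.mem_erase.mpr ⟨hpq, hp⟩
      have h0 : Ideal.Quotient.mk p.asIdeal r = 0 := Ideal.Quotient.eq_zero_iff_mem.mpr (hr p hp')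
      have := ha p hp'
      rw [eval_mem_iff_aeval_eq_zero] at this ⊢
      simpa [h0] using this

/-! ### Divisibility of the determinant, by Cayley–Hamilton -/

open Polynomial in
/-- If `C` represents an endomorphism `θ` of an `R`-module with more structure, then `θ` divides
`det C`. -/
theorem exists_mul_eq_det_smul {R B N ι : Type*} [CommRing R] [Ring B] [AddCommGroup N] [Module R N]
    [Module B N] [SMulCommClass B R N] [SMul R B] [IsScalarTower R B N] [Fintype ι] [DecidableEq ι]
    (b : ι → N) (hb : Submodule.span R (Set.range b) = ⊤) (θ : Module.End B N) (C : Matrix ι ι R)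
    (hC : ∀ j, ∑ i, C i j • b i = θ (b j)) :
    ∃ ψ : Module.End B N, ∀ x, θ (ψ x) = C.det • x := by
  let ρ : Module.End B N →ₐ[R] Module.End R N :=
    { toFun := fun φ => φ.restrictScalars R
      map_one' := rfl
      map_mul' := fun _ _ => rfl
      map_zero' := rfl
      map_add' := fun _ _ => rfl
      commutes' := fun r => rfl }
  have hrep : C.Represents b (ρ θ) := Matrix.represents_iff'.mpr hC
  let C' : Matrix.isRepresentation R b := ⟨C, _, hrep⟩
  have h1 : Matrix.isRepresentation.toEnd R b hb C' = ρ θ :=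
    Matrix.isRepresentation.eq_toEnd_of_represents R b hb C' hrep
  have h2 : aeval (ρ θ) C.charpoly = 0 := by
    rw [← h1, Polynomial.aeval_algHom_apply, ← map_zero (Matrix.isRepresentation.toEnd R b hb)]
    congr 1
    ext1
    rw [Polynomial.aeval_subalgebra_coe, Matrix.aeval_self_charpoly, Subalgebra.coe_zero]
  have h3 : aeval θ C.charpoly = 0 := by
    rw [Polynomial.aeval_algHom_apply] at h2
    ext x
    exact LinearMap.congr_fun h2 x
  have h4 := Polynomial.divX_mul_X_add C.charpoly
  rw [← h4] at h3
  simp only [map_add, map_mul, aeval_X, aeval_C] at h3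
  -- Cayley–Hamilton reads `θ * divX(θ) = -(constant term)`, and the constant term is `± det C`.
  -- Being a polynomial in `θ`, the cofactor is `B`-linear; the adjugate of `C` need not even
  -- respect the relations among the `b i`.
  refine ⟨-((-1) ^ Fintype.card ι : R) • aeval θ C.charpoly.divX, fun x => ?_⟩
  have h5 : θ * aeval θ C.charpoly.divX = aeval θ C.charpoly.divX * θ := by
    have := congrArg (aeval θ) (mul_comm X C.charpoly.divX)
    simpa using this
  have h6 := LinearMap.congr_fun h3 x
  rw [← h5] at h6
  have h7 : θ (aeval θ C.charpoly.divX x) = - (C.charpoly.coeff 0 • x) := by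
    rw [eq_neg_iff_add_eq_zero]
    simpa [Module.algebraMap_end_apply] using h6
  have h8 : C.charpoly.coeff 0 = (-1) ^ Fintype.card ι * C.det := by
    rw [Matrix.det_eq_sign_charpoly_coeff, ← mul_assoc, ← mul_pow]; simp
  rw [LinearMap.smul_apply, θ.map_smul_of_tower, h7, h8, smul_neg, neg_smul, neg_neg, smul_smul,
    ← mul_assoc, ← mul_pow]
  simp

open MulOpposite

/-! ### Splittings and denominators -/

section Split

variable {R S M N : Type*} [CommRing R] [Ring S] [Algebra R S]
variable [AddCommGroup M] [Module R M] [Module Sᵐᵒᵖ M] [IsScalarTower R Sᵐᵒᵖ M]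
variable [AddCommGroup N] [Module R N] [Module Sᵐᵒᵖ N] [IsScalarTower R Sᵐᵒᵖ N]
variable (T : Submonoid R)

/-- A finitely generated submodule that is locally killed is killed by one denominator. -/
theorem exists_forall_smul_eq_zero {W : Type*} [AddCommGroup W] [Module Sᵐᵒᵖ W]
    (φ : W →ₗ[Sᵐᵒᵖ] M) (K : Submodule Sᵐᵒᵖ W) (hK : K.FG)
    (h : ∀ w ∈ K, ∃ u ∈ T, u • φ w = 0) : ∃ u ∈ T, ∀ w ∈ K, u • φ w = 0 := by
  obtain ⟨s, rfl⟩ := hK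
  choose! u hu hu' using h
  refine ⟨∏ x ∈ s, u x, T.prod_mem fun x hx => hu x (Submodule.subset_span hx), fun w hw => ?_⟩
  have hle : Submodule.span Sᵐᵒᵖ (s : Set W) ≤ LinearMap.ker ((∏ x ∈ s, u x) • φ) := by
    refine Submodule.span_le.mpr fun x hx => ?_
    obtain ⟨c, hc⟩ := Finset.dvd_prod_of_mem u hx
    rw [SetLike.mem_coe, LinearMap.mem_ker, LinearMap.smul_apply, hc, mul_comm, mul_smul,
      hu' x (Submodule.subset_span hx), smul_zero]
  exact hle hw

/-- Homomorphisms between localizations whose source is the localization of a finitely presented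
module have a common denominator. -/
theorem exists_lift [Module.FinitePresentation Sᵐᵒᵖ N]
    (γ : LocalizedModule T N →ₗ[(LocalizedModule T S)ᵐᵒᵖ] LocalizedModule T M) :
    ∃ (g : N →ₗ[Sᵐᵒᵖ] M) (t : T), ∀ x,
      γ (LocalizedModule.mk x 1) = LocalizedModule.mk (g x) t := by
  obtain ⟨m, K, e, hK⟩ := Module.FinitePresentation.exists_fin Sᵐᵒᵖ N
  let π : (Fin m → Sᵐᵒᵖ) →ₗ[Sᵐᵒᵖ] N := e.symm.toLinearMap ∘ₗ K.mkQ
  let b := Pi.basisFun Sᵐᵒᵖ (Fin m)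
  have hrep : ∀ i, ∃ (y : M) (t : T),
      γ (LocalizedModule.mk (π (b i)) 1) = LocalizedModule.mk y t := by
    intro i
    generalize γ (LocalizedModule.mk (π (b i)) 1) = z
    induction z with | _ y t
    exact ⟨y, t, rfl⟩
  choose y t hyt using hrep
  let t₀ : T := ∏ i, t i
  -- Each numerator is multiplied by all denominators but its own, giving the common denominator
  -- `t₀`.
  let G : (Fin m → Sᵐᵒᵖ) →ₗ[Sᵐᵒᵖ] M := b.constr ℕ fun i =>
    ((∏ j ∈ Finset.univ.erase i, t j : T) : R) • y i
  have hG : ∀ w, γ (LocalizedModule.mk (π w) 1) = LocalizedModule.mk (G w) t₀ := by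
    intro w
    induction (b.span_eq ▸ Submodule.mem_top : w ∈ Submodule.span Sᵐᵒᵖ (Set.range b))
      using Submodule.span_induction with
    | mem w hw =>
      obtain ⟨i, rfl⟩ := hw
      rw [hyt, Module.Basis.constr_basis]
      refine LocalizedModule.mk_eq.mpr ⟨1, ?_⟩
      have ht : t₀ = t i * ∏ j ∈ Finset.univ.erase i, t j :=
        (Finset.mul_prod_erase _ _ (Finset.mem_univ i)).symm
      simp [ht, Submonoid.smul_def, smul_smul]
    | zero => simp
    | add v w _ _ hv hw =>
      have : (LocalizedModule.mk (π (v + w)) 1 : LocalizedModule T N) =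
          LocalizedModule.mk (π v) 1 + LocalizedModule.mk (π w) 1 := by
        rw [map_add, LocalizedModule.mk_add_mk]; simp
      rw [this, map_add, hv, hw, LocalizedModule.mk_add_mk, map_add]
      refine LocalizedModule.mk_eq.mpr ⟨1, ?_⟩
      simp [mul_smul]
    | smul a w _ hw =>
      have : (LocalizedModule.mk (π (a • w)) 1 : LocalizedModule T N) =
          op (LocalizedModule.mk (unop a) (1 : T)) • LocalizedModule.mk (π w) (1 : T) := by
        rw [map_smul, op_mk_smul_mk]; simp
      rw [this, map_smul, hw, op_mk_smul_mk, map_smul]; simp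
  -- Relations are sent to zero only after localization. They are finitely generated, so a single
  -- `u` kills their images and `u • G` descends to `N`.
  obtain ⟨u, hu, hu'⟩ := exists_forall_smul_eq_zero T G K hK fun w hw => by
    have h0 : π w = 0 := by
      simp [π, (Submodule.Quotient.mk_eq_zero K).mpr hw]
    have := hG w
    rw [h0, LocalizedModule.zero_mk, map_zero, ← LocalizedModule.zero_mk (M := M) t₀] at this
    obtain ⟨c, hc⟩ := LocalizedModule.mk_eq.mp this
    refine ⟨c * t₀, T.mul_mem c.2 t₀.2, ?_⟩
    simpa [Submonoid.smul_def, mul_smul] using hc.symm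
  refine ⟨K.liftQ (u • G) (fun w hw => hu' w hw) ∘ₗ e.toLinearMap, ⟨u, hu⟩ * t₀, fun x => ?_⟩
  obtain ⟨w, hw⟩ := K.mkQ_surjective (e x)
  have hx : x = π w := by simp [π, hw]
  rw [hx, hG]
  have : e (π w) = K.mkQ w := by simp [π]
  have hl : K.liftQ (u • G) (fun w hw => hu' w hw) (K.mkQ w) = u • G w := Submodule.liftQ_apply ..
  rw [LinearMap.comp_apply, LinearEquiv.coe_coe, this, hl]
  refine LocalizedModule.mk_eq.mpr ⟨1, ?_⟩
  simp [Submonoid.smul_def, smul_smul, mul_comm]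

/-- A tuple of homomorphisms `M → N` has, up to a denominator in `T`, a dual tuple. -/
def IsSplitTuple {ι : Type*} [DecidableEq ι] (h : ι → (M →ₗ[Sᵐᵒᵖ] N)) : Prop :=
  ∃ s ∈ T, ∃ g : ι → (N →ₗ[Sᵐᵒᵖ] M), ∀ i j x, h i (g j x) = if i = j then s • x else 0

variable {T}

theorem IsSplitTuple.isSplitSurjective {ι : Type*} [Fintype ι] [DecidableEq ι]
    {h : ι → (M →ₗ[Sᵐᵒᵖ] N)} (hh : IsSplitTuple T h) :
    IsSplitSurjective (localizedMap T (LinearMap.pi h)) := by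
  obtain ⟨s, hs, g, hg⟩ := hh
  let G : (ι → N) →ₗ[Sᵐᵒᵖ] M := ∑ j, g j ∘ₗ LinearMap.proj j
  have hG : ∀ y, LinearMap.pi h (G y) = s • y := by
    intro y
    ext i
    simp [G, hg]
  -- Division by `s`, which is linear over the localized ring because `s` comes from the central
  -- image of `R`.
  let U : LocalizedModule T (ι → N) →ₗ[(LocalizedModule T S)ᵐᵒᵖ] LocalizedModule T (ι → N) :=
    { toFun := fun y => op (LocalizedModule.mk (1 : S) (⟨s, hs⟩ : T)) • y
      map_add' := smul_add _
      map_smul' := fun x y => by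
        induction x using MulOpposite.rec' with | _ x
        induction x with | _ a u
        induction y with | _ m v
        simp only [RingHom.id_apply, op_mk_smul_mk, op_one, one_smul]
        rw [mul_left_comm] }
  refine ⟨localizedMap T G ∘ₗ U, LinearMap.ext fun y => ?_⟩
  induction y with | _ y v
  change localizedMap T (LinearMap.pi h) (localizedMap T G
    (op (LocalizedModule.mk (1 : S) (⟨s, hs⟩ : T)) • LocalizedModule.mk y v)) = _
  rw [op_mk_smul_mk, localizedMap_mk, localizedMap_mk, op_one, one_smul, hG]
  refine LocalizedModule.mk_eq.mpr ⟨1, ?_⟩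
  simp [Submonoid.smul_def, smul_smul, mul_comm]

/-- The components of the right inverse lift to maps `N → M` up to a denominator. The duality
equations then hold after localization, hence up to one further denominator because `N` is finitely
generated. -/
theorem isSplitTuple_of_isSplitSurjective {ι : Type*} [Fintype ι] [DecidableEq ι]
    [Module.FinitePresentation Sᵐᵒᵖ N] {h : ι → (M →ₗ[Sᵐᵒᵖ] N)}
    (hh : IsSplitSurjective (localizedMap T (LinearMap.pi h))) : IsSplitTuple T h := by
  obtain ⟨γ, hγ⟩ := hh
  have key : ∀ j, ∃ s ∈ T, ∃ g : N →ₗ[Sᵐᵒᵖ] M, ∀ i x,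
      h i (g x) = if i = j then s • x else 0 := by
    intro j
    obtain ⟨g, t, hg⟩ := exists_lift T
      (γ ∘ₗ localizedMap T (LinearMap.single Sᵐᵒᵖ (fun _ : ι => N) j))
    let φ : N →ₗ[Sᵐᵒᵖ] (ι → N) :=
      LinearMap.pi h ∘ₗ g - (t : R) • LinearMap.single Sᵐᵒᵖ (fun _ : ι => N) j
    obtain ⟨u, hu, hu'⟩ := exists_forall_smul_eq_zero T φ ⊤ Module.Finite.fg_top fun x _ => by
      have h1 := congrArg (localizedMap T (LinearMap.pi h)) (hg x)
      rw [LinearMap.comp_apply, localizedMap_mk, localizedMap_mk, ← LinearMap.comp_apply, hγ,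
        LinearMap.id_apply] at h1
      obtain ⟨c, hc⟩ := LocalizedModule.mk_eq.mp h1
      refine ⟨c, c.2, ?_⟩
      simp only [one_smul] at hc
      simp only [φ, LinearMap.sub_apply, LinearMap.comp_apply, LinearMap.smul_apply, smul_sub]
      rw [sub_eq_zero]
      exact hc.symm
    refine ⟨u * t, T.mul_mem hu t.2, u • g, fun i x => ?_⟩
    have h2 := congrFun (hu' x Submodule.mem_top) i
    simp only [φ, LinearMap.sub_apply, LinearMap.comp_apply, LinearMap.smul_apply, smul_sub,
      Pi.sub_apply, Pi.smul_apply, LinearMap.pi_apply, LinearMap.coe_single, Pi.zero_apply,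
      sub_eq_zero] at h2
    rw [LinearMap.smul_apply, (h i).map_smul_of_tower, h2]
    by_cases hij : i = j
    · subst hij; simp [mul_smul]
    · simp [hij]
  choose s hs g hg using key
  -- Scaling each dual map by the factors belonging to the other indices equalizes the denominators.
  refine ⟨∏ j, s j, T.prod_mem fun j _ => hs j,
    fun j => (∏ i ∈ Finset.univ.erase j, s i) • g j, fun i j x => ?_⟩
  rw [LinearMap.smul_apply, (h i).map_smul_of_tower, hg]
  split_ifs with hij
  · rw [smul_smul, Finset.prod_erase_mul _ _ (Finset.mem_univ j)]
  · rw [smul_zero]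

end Split

/-! ### Modifying split tuples -/

section SplitTuple

variable {R S M N : Type*} [CommRing R] [Ring S] [Algebra R S]
variable [AddCommGroup M] [Module R M] [Module Sᵐᵒᵖ M] [IsScalarTower R Sᵐᵒᵖ M]
variable [AddCommGroup N] [Module R N] [Module Sᵐᵒᵖ N] [IsScalarTower R Sᵐᵒᵖ N]
variable {T : Submonoid R}

theorem IsSplitTuple.comp_injective {ι κ : Type*} [DecidableEq ι] [DecidableEq κ]
    {h : ι → (M →ₗ[Sᵐᵒᵖ] N)} (hh : IsSplitTuple T h) (φ : κ → ι) (hφ : Function.Injective φ) :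
    IsSplitTuple T (h ∘ φ) := by
  obtain ⟨s, hs, g, hg⟩ := hh
  exact ⟨s, hs, g ∘ φ, fun i j x => by simp [hg, hφ.eq_iff]⟩

/-- Elimination with pivot `j`: the dual maps with index other than `j` kill `h j`, so they stay
dual up to the factor `μ j`. -/
theorem IsSplitTuple.smul_sub_smul {k : ℕ} {h : Fin (k + 1) → (M →ₗ[Sᵐᵒᵖ] N)}
    (hh : IsSplitTuple T h) (μ : Fin (k + 1) → R) (j : Fin (k + 1)) (hj : μ j ∈ T) :
    IsSplitTuple T fun i => μ j • h (j.succAbove i) - μ (j.succAbove i) • h j := by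
  obtain ⟨s, hs, g, hg⟩ := hh
  refine ⟨μ j * s, T.mul_mem hj hs, fun i => g (j.succAbove i), fun i l x => ?_⟩
  simp [hg, (Fin.succAbove_ne j l).symm, mul_smul]

/-- Adding multiples of a homomorphism `e` to a split tuple gives a split tuple, provided that
the determinant of a matrix over `R` is invertible. -/
theorem isSplitTuple_add_smul {ι ν : Type*} [Fintype ι] [DecidableEq ι] [Fintype ν]
    [DecidableEq ν] (b : ν → N) (hb : Submodule.span R (Set.range b) = ⊤)
    {h : ι → (M →ₗ[Sᵐᵒᵖ] N)} {s : R} (hs : s ∈ T) {g : ι → (N →ₗ[Sᵐᵒᵖ] M)}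
    (hg : ∀ i j x, h i (g j x) = if i = j then s • x else 0)
    (e : M →ₗ[Sᵐᵒᵖ] N) (G : ι → Matrix ν ν R)
    (hG : ∀ l j, ∑ i, G l i j • b i = e (g l (b j))) (μ : ι → R)
    (hdet : (s • 1 + ∑ l, μ l • G l).det ∈ T) :
    IsSplitTuple T fun i => h i + μ i • e := by
  let Γ : N →ₗ[Sᵐᵒᵖ] M := ∑ l, μ l • g l
  let θ : Module.End Sᵐᵒᵖ N := s • LinearMap.id + e ∘ₗ Γ
  obtain ⟨ψ, hψ⟩ := exists_mul_eq_det_smul b hb θ (s • 1 + ∑ l, μ l • G l) (fun j => by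
    simp only [Matrix.add_apply, Matrix.smul_apply, Matrix.sum_apply, add_smul,
      Finset.sum_add_distrib, Finset.sum_smul, smul_eq_mul, mul_smul]
    rw [Finset.sum_comm]
    simp only [← Finset.smul_sum, hG]
    simp [θ, Γ, Matrix.one_apply])
  have hΓ : ∀ i z, h i (Γ z) = (μ i * s) • z := by
    intro i z
    simp [Γ, hg, mul_smul]
  have hθ : ∀ z, e (Γ z) = θ z - s • z := by
    intro z
    simp [θ]
  -- A rank-one update formula with `θ = s + e Γ` in place of the scalar denominator: its inverse is
  -- `ψ / det`, and the correction `Γ ψ e g` cancels the terms in `e`.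
  refine ⟨(s • 1 + ∑ l, μ l • G l).det * s, T.mul_mem hdet hs,
    fun m => (s • 1 + ∑ l, μ l • G l).det • g m - Γ ∘ₗ ψ ∘ₗ e ∘ₗ g m, fun i j x => ?_⟩
  generalize (s • 1 + ∑ l, μ l • G l).det = σ at *
  simp only [LinearMap.add_apply, LinearMap.smul_apply, LinearMap.sub_apply, LinearMap.comp_apply,
    map_sub, hΓ, hθ, hψ, LinearMap.map_smul_of_tower, hg]
  split_ifs <;> module

variable (T) in
/-- Some tuple of `k` members of `F` splits after inverting `T`. -/
def HasSplit (k : ℕ) (F : Submodule R (M →ₗ[Sᵐᵒᵖ] N)) : Prop :=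
  ∃ h : Fin k → (M →ₗ[Sᵐᵒᵖ] N), (∀ i, h i ∈ F) ∧ IsSplitTuple T h

theorem HasSplit.mono {k l : ℕ} {F : Submodule R (M →ₗ[Sᵐᵒᵖ] N)} (hF : HasSplit T l F)
    (hkl : k ≤ l) : HasSplit T k F := by
  obtain ⟨h, hF, hh⟩ := hF
  exact ⟨h ∘ Fin.castLE hkl, fun i => hF _, hh.comp_injective _ (Fin.castLE_injective hkl)⟩

theorem hasSplit_zero (F : Submodule R (M →ₗ[Sᵐᵒᵖ] N)) : HasSplit T 0 F :=
  ⟨Fin.elim0, fun i => i.elim0, 1, T.one_mem, Fin.elim0, fun i => i.elim0⟩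

/-- Split tuples may be shortened, so a supremum of at least `k` is witnessed by a tuple of length
exactly `k`. -/
theorem natCast_le_delta_iff [Module.FinitePresentation Sᵐᵒᵖ N] {p : PrimeSpectrum R} {k : ℕ}
    {F : Submodule R (M →ₗ[Sᵐᵒᵖ] N)} :
    (k : ℕ∞) ≤ delta p F ↔ HasSplit p.asIdeal.primeCompl k F := by
  constructor
  · intro hk
    cases k with
    | zero => exact hasSplit_zero F
    | succ k =>
      have hlt : (k : ℕ∞) < delta p F := lt_of_lt_of_le (by exact_mod_cast k.lt_succ_self) hk
      obtain ⟨_, ⟨t, rfl, h, hF, hh⟩, hkt⟩ := lt_sSup_iff.mp hlt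
      refine HasSplit.mono ⟨h, hF, isSplitTuple_of_isSplitSurjective hh⟩ ?_
      exact_mod_cast hkt
  · rintro ⟨h, hF, hh⟩
    exact le_sSup ⟨k, rfl, h, hF, hh.isSplitSurjective⟩

theorem exists_matrix_represents {ν : Type*} [Fintype ν] (b : ν → N)
    (hb : Submodule.span R (Set.range b) = ⊤) (φ : N → N) :
    ∃ G : Matrix ν ν R, ∀ j, ∑ i, G i j • b i = φ (b j) := by
  have : ∀ j, ∃ c : ν → R, ∑ i, c i • b i = φ (b j) := fun j =>
    (Submodule.mem_span_range_iff_exists_fun R).mp (hb ▸ Submodule.mem_top)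
  choose c hc using this
  exact ⟨Matrix.of fun i j => c j i, hc⟩

variable [Module.Finite R N]

/-- Passing from `F` to a submodule `F'` with `F ⊆ F' + R e` costs at most one splitting. -/
theorem HasSplit.of_succ {F F' : Submodule R (M →ₗ[Sᵐᵒᵖ] N)} {e : M →ₗ[Sᵐᵒᵖ] N}
    (hF' : ∀ h ∈ F, ∃ μ : R, h + μ • e ∈ F') (p : Ideal R) [p.IsPrime] {k : ℕ}
    (hF : HasSplit p.primeCompl (k + 1) F) : HasSplit p.primeCompl k F' := by
  obtain ⟨h, hF, hh⟩ := hF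
  choose μ hμ using fun i => hF' (h i) (hF i)
  -- If every `μ i` lies in `p`, the determinant is a power of `s` modulo `p` and nothing is lost.
  -- Otherwise some `μ j ∉ p` serves as a pivot to eliminate `e`, at the cost of `h j`.
  by_cases hp : ∀ i, μ i ∈ p
  · refine HasSplit.mono (l := k + 1) ⟨_, hμ, ?_⟩ k.le_succ
    obtain ⟨m, b, hb⟩ := Module.Finite.exists_fin (R := R) (M := N)
    obtain ⟨s, hs, g, hg⟩ := hh
    choose G hG using fun l => exists_matrix_represents b hb fun x => e (g l x)
    refine isSplitTuple_add_smul b hb hs hg e G hG μ ?_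
    intro hdet
    rw [SetLike.mem_coe, ← Ideal.Quotient.eq_zero_iff_mem, RingHom.map_det] at hdet
    have h0 : (Ideal.Quotient.mk p).mapMatrix (s • 1 + ∑ l, μ l • G l) =
        Ideal.Quotient.mk p s • 1 := by
      ext i j
      by_cases hij : i = j <;>
        simp [Matrix.sum_apply, hij, Ideal.Quotient.eq_zero_iff_mem.mpr (hp _)]
    rw [h0, Matrix.det_smul, Matrix.det_one, mul_one] at hdet
    exact pow_ne_zero _ (mt Ideal.Quotient.eq_zero_iff_mem.mp hs) hdet
  · push Not at hp
    obtain ⟨j, hj⟩ := hp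
    refine ⟨_, fun i => ?_, hh.smul_sub_smul μ j hj⟩
    have := F'.sub_mem (F'.smul_mem (μ j) (hμ (j.succAbove i)))
      (F'.smul_mem (μ (j.succAbove i)) (hμ j))
    convert this using 1
    module

/-! ### Removing a generator -/

open MvPolynomial in
/-- If `F`, generated by `n + 1` elements, admits a split tuple of at most `n` elements at `p`,
then so does the submodule generated by `f i + a i • e`, where `e` is a combination of the
generators subject to an open condition, and `a` is subject to an open condition. -/
theorem HasSplit.exists_polynomial {n k : ℕ} (f : Fin (n + 1) → (M →ₗ[Sᵐᵒᵖ] N)) (p : Ideal R)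
    [p.IsPrime] (hk : k ≤ n) (hF : HasSplit p.primeCompl k (Submodule.span R (Set.range f))) :
    ∃ c : Fin (n + 1) → R, (∃ j, c j ∉ p) ∧
      ∀ b : Fin n → R, c (Fin.last n) + ∑ i, b i * c i.castSucc ∉ p →
        ∃ P : MvPolynomial (Fin n) R, (∃ z : Fin n → FractionRing (R ⧸ p), aeval z P ≠ 0) ∧
          ∀ a : Fin n → R, eval a P ∉ p →
            HasSplit p.primeCompl k (Submodule.span R (Set.range fun i : Fin n =>
              f i.castSucc + a i • (f (Fin.last n) + ∑ j, b j • f j.castSucc))) := by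
  obtain ⟨h, hF, s, hs, g, hg⟩ := hF
  choose v hv using fun l => (Submodule.mem_span_range_iff_exists_fun R).mp (hF l)
  -- The `k × (n + 1)` coefficient matrix over the domain `R ⧸ p` cannot be injective since `k ≤ n`;
  -- `c` lifts a nonzero kernel vector.
  obtain ⟨c, hc, hcv⟩ : ∃ c : Fin (n + 1) → R, (∃ j, c j ∉ p) ∧ ∀ l, ∑ j, v l j * c j ∈ p := by
    let V : Matrix (Fin k) (Fin (n + 1)) (R ⧸ p) := Matrix.of fun l j => Ideal.Quotient.mk p (v l j)
    have hV : ¬ Function.Injective V.mulVecLin := fun hinj => by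
      have := le_of_fin_injective _ V.mulVecLin hinj
      omega
    rw [← LinearMap.ker_eq_bot, Submodule.eq_bot_iff] at hV
    push Not at hV
    obtain ⟨c, hc, hc0⟩ := hV
    choose c' hc' using fun j => Ideal.Quotient.mk_surjective (I := p) (c j)
    refine ⟨c', ?_, fun l => ?_⟩
    · by_contra! hall
      exact hc0 (funext fun j => by
        rw [← hc', Pi.zero_apply, Ideal.Quotient.eq_zero_iff_mem.mpr (hall j)])
    · have := congrFun (LinearMap.mem_ker.mp hc) l
      simp only [V, Matrix.mulVecLin_apply, Matrix.mulVec, dotProduct, Matrix.of_apply, ← hc',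
        Pi.zero_apply] at this
      rw [← Ideal.Quotient.eq_zero_iff_mem]
      simpa using this
  refine ⟨c, hc, fun b hb => ?_⟩
  obtain ⟨m, y, hy⟩ := Module.Finite.exists_fin (R := R) (M := N)
  set e := f (Fin.last n) + ∑ j, b j • f j.castSucc with he
  choose G hG using fun l => exists_matrix_represents y hy fun x => e (g l x)
  -- Replacing `f_last` by `e - ∑ b j • f j` gives `h l = ∑ w l i • f i + v l last • e`. Hence `h l
  -- + μ l • e` lies in the new span exactly for the following choice of `μ`.
  let w : Fin k → Fin n → R := fun l i => v l i.castSucc - v l (Fin.last n) * b i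
  let μ : Fin k → MvPolynomial (Fin n) R := fun l =>
    ∑ i, C (w l i) * X i - C (v l (Fin.last n))
  let D : Matrix (Fin m) (Fin m) (MvPolynomial (Fin n) R) :=
    (C s : MvPolynomial (Fin n) R) • (1 : Matrix _ _ _) + ∑ l, μ l • (G l).map C
  let K := FractionRing (R ⧸ p)
  refine ⟨D.det, ?_, fun a ha => ?_⟩
  · let d : K := algebraMap R K (c (Fin.last n) + ∑ i, b i * c i.castSucc)
    have hd : d ≠ 0 := by rwa [Ne, algebraMap_fractionRing_quotient_eq_zero_iff]
    -- The kernel relation becomes `∑ w l i * c i + v l last * d = 0`. Thus every `μ l` vanishes at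
    -- `-c / d`, where `D` reduces to the scalar matrix `s`.
    let z : Fin n → K := fun i => -algebraMap R K (c i.castSucc) / d
    have hμ : ∀ l, aeval z (μ l) = 0 := by
      intro l
      have h1 : ∑ i, w l i * c i.castSucc + (c (Fin.last n) + ∑ i, b i * c i.castSucc) *
          v l (Fin.last n) ∈ p := by
        convert hcv l using 1
        rw [Fin.sum_univ_castSucc]
        simp only [w, sub_mul, Finset.sum_sub_distrib, add_mul, Finset.sum_mul]
        have : ∀ i, v l (Fin.last n) * b i * c i.castSucc = b i * c i.castSucc * v l (Fin.last n) :=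
          fun i => by ring
        simp only [this]
        ring
      rw [← algebraMap_fractionRing_quotient_eq_zero_iff p, map_add, map_sum, map_mul] at h1
      have h2 : d * aeval z (μ l) = 0 := by
        have h3 : ∀ i, d * (algebraMap R K (w l i) * z i) =
            - algebraMap R K (w l i * c i.castSucc) := by
          intro i
          change d * (_ * (-algebraMap R K (c i.castSucc) / d)) = _
          rw [mul_left_comm, mul_div_cancel₀ _ hd, mul_neg, map_mul]
        have h4 : aeval z (μ l) = ∑ i, algebraMap R K (w l i) * z i -
            algebraMap R K (v l (Fin.last n)) := by
          simp only [μ, map_sub, map_sum, map_mul, algHom_C, aeval_X, K]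
        rw [h4, mul_sub, Finset.mul_sum, Finset.sum_congr rfl fun i _ => h3 i,
          Finset.sum_neg_distrib, ← neg_eq_zero, ← h1]
        simp only [d, K]
        ring
      exact (mul_eq_zero.mp h2).resolve_left hd
    refine ⟨z, ?_⟩
    rw [AlgHom.map_det]
    have h0 : (aeval z).mapMatrix D = algebraMap R K s • 1 := by
      ext i j
      by_cases hij : i = j <;> simp [D, Matrix.sum_apply, hij, hμ, K]
    rw [h0, Matrix.det_smul, Matrix.det_one, mul_one]
    exact pow_ne_zero _ (mt (algebraMap_fractionRing_quotient_eq_zero_iff p s).mp hs)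
  · refine ⟨fun l => h l + eval a (μ l) • e, fun l => ?_,
      isSplitTuple_add_smul y hy hs hg e G hG _ ?_⟩
    · refine (Submodule.mem_span_range_iff_exists_fun R).mpr ⟨w l, ?_⟩
      beta_reduce
      rw [← hv, Fin.sum_univ_castSucc]
      simp only [μ, w, map_sub, map_sum, map_mul, eval_C, eval_X, smul_add, Finset.sum_add_distrib,
        sub_smul, Finset.sum_sub_distrib, Finset.sum_smul, smul_smul]
      have h5 : f (Fin.last n) = e - ∑ j, b j • f j.castSucc := by rw [he]; abel
      rw [h5]
      simp only [smul_sub, Finset.smul_sum, smul_smul]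
      abel
    · intro hdet
      apply ha
      rw [SetLike.mem_coe] at hdet
      convert hdet
      rw [RingHom.map_det]
      congr 1
      ext i j
      by_cases hij : i = j <;> simp [D, Matrix.sum_apply, hij]

open MvPolynomial in
/-- One generator can be removed from `F` without losing the splittings at finitely many primes,
and losing at most one splitting at the other primes. -/
theorem exists_remove_generator {n : ℕ} (f : Fin (n + 1) → (M →ₗ[Sᵐᵒᵖ] N))
    (Λ : Finset (PrimeSpectrum R)) (k : PrimeSpectrum R → ℕ) (hk : ∀ p ∈ Λ, k p ≤ n)
    (hf : ∀ p ∈ Λ, HasSplit p.asIdeal.primeCompl (k p) (Submodule.span R (Set.range f))) :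
    ∃ f' : Fin n → (M →ₗ[Sᵐᵒᵖ] N), (∀ i, f' i ∈ Submodule.span R (Set.range f)) ∧
      (∀ p ∈ Λ, HasSplit p.asIdeal.primeCompl (k p) (Submodule.span R (Set.range f'))) ∧
      ∀ (p : PrimeSpectrum R) (l : ℕ),
        HasSplit p.asIdeal.primeCompl (l + 1) (Submodule.span R (Set.range f)) →
          HasSplit p.asIdeal.primeCompl l (Submodule.span R (Set.range f')) := by
  classical
  choose! c hc hcP using fun p hp =>
    HasSplit.exists_polynomial f (PrimeSpectrum.asIdeal p) (hk p hp) (hf p hp)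
  -- The last coordinate of the kernel vector may lie in `p`; `b` is chosen so that `d` avoids every
  -- prime of `Λ`. The linear polynomial is nonzero at `0` or at a unit vector.
  obtain ⟨b, hb⟩ := exists_forall_eval_notMem Λ
    (fun p => C (c p (Fin.last n)) + ∑ i : Fin n, X i * C (c p i.castSucc)) (fun p hp => by
      simp only [map_add, map_sum, map_mul, algHom_C, aeval_X]
      obtain ⟨j, hj⟩ := hc p hp
      by_cases h0 : c p (Fin.last n) ∈ p.asIdeal
      · induction j using Fin.lastCases with
        | last => exact absurd h0 hj
        | cast j =>
          refine ⟨Pi.single j 1, ?_⟩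
          rw [(algebraMap_fractionRing_quotient_eq_zero_iff _ _).mpr h0, zero_add,
            Finset.sum_eq_single j (fun i _ hi => by simp [hi]) (by simp)]
          simpa [algebraMap_fractionRing_quotient_eq_zero_iff] using hj
      · refine ⟨0, ?_⟩
        simpa [algebraMap_fractionRing_quotient_eq_zero_iff] using h0)
  simp only [map_add, map_sum, map_mul, eval_C, eval_X] at hb
  choose! P hP hPs using fun p hp => hcP p hp b (hb p hp)
  obtain ⟨a, ha⟩ := exists_forall_eval_notMem Λ P hP
  set e := f (Fin.last n) + ∑ j : Fin n, b j • f j.castSucc with he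
  have hmem : ∀ j, f j ∈ Submodule.span R (Set.range f) := fun j =>
    Submodule.subset_span (Set.mem_range_self j)
  have heF : e ∈ Submodule.span R (Set.range f) :=
    add_mem (hmem _) (sum_mem fun j _ => Submodule.smul_mem _ _ (hmem _))
  refine ⟨fun i => f i.castSucc + a i • e, fun i => add_mem (hmem _) (Submodule.smul_mem _ _ heF),
    fun p hp => hPs p hp a (ha p hp), fun p l hl => HasSplit.of_succ (e := e) ?_ p.asIdeal hl⟩
  intro h hh
  obtain ⟨v, rfl⟩ := (Submodule.mem_span_range_iff_exists_fun R).mp hh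
  refine ⟨∑ i : Fin n, (v i.castSucc - v (Fin.last n) * b i) * a i - v (Fin.last n),
    (Submodule.mem_span_range_iff_exists_fun R).mpr
      ⟨fun i => v i.castSucc - v (Fin.last n) * b i, ?_⟩⟩
  rw [Fin.sum_univ_castSucc]
  have h5 : f (Fin.last n) = e - ∑ j, b j • f j.castSucc := by rw [he]; abel
  rw [h5]
  simp only [smul_add, Finset.sum_add_distrib, sub_smul, Finset.sum_sub_distrib, Finset.sum_smul,
    smul_smul, smul_sub, Finset.smul_sum]
  abel

end SplitTuple

/-! ### Dimension and minimal primes in basic sets -/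

section BasicSet

variable {R : Type*} [CommRing R] {X : Set (PrimeSpectrum R)}

/-- `V(p) ∩ X` is the closure of its point `p`, hence irreducible. It lies strictly above the
closure of every irreducible closed subset of `V(q) ∩ X`, since these closures omit `p`; so each
chain for `q` extends by one step. -/
theorem dimAt_add_one_le {p q : PrimeSpectrum R} (hp : p ∈ X) (hq : q ∈ X) (hpq : p < q) :
    dimAt X q + 1 ≤ dimAt X p := by
  let Yp := ↥(PrimeSpectrum.zeroLocus (p.asIdeal : Set R) ∩ X)
  let Yq := ↥(PrimeSpectrum.zeroLocus (q.asIdeal : Set R) ∩ X)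
  have hsub : PrimeSpectrum.zeroLocus (q.asIdeal : Set R) ∩ X ⊆
      PrimeSpectrum.zeroLocus (p.asIdeal : Set R) ∩ X :=
    Set.inter_subset_inter_left _ (PrimeSpectrum.zeroLocus_anti_mono hpq.le)
  let j : Yq → Yp := Set.inclusion hsub
  have hj : Topology.IsInducing j := (Topology.IsEmbedding.inclusion hsub).isInducing
  let p' : Yp := ⟨p, fun _ h => h, hp⟩
  let q' : Yq := ⟨q, fun _ h => h, hq⟩
  have hcl : closure {p'} = Set.univ := by
    refine Set.eq_univ_of_forall fun y => ?_
    rw [closure_subtype, Set.image_singleton, ← PrimeSpectrum.le_iff_mem_closure]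
    exact y.2.1
  let top : TopologicalSpace.IrreducibleCloseds Yp :=
    ⟨Set.univ, hcl ▸ isIrreducible_singleton.closure, isClosed_univ⟩
  have : Nonempty (TopologicalSpace.IrreducibleCloseds Yq) :=
    ⟨⟨closure {q'}, isIrreducible_singleton.closure, isClosed_closure⟩⟩
  let Φ : WithTop (TopologicalSpace.IrreducibleCloseds Yq) →
      TopologicalSpace.IrreducibleCloseds Yp :=
    fun Z => WithTop.recTopCoe top (TopologicalSpace.IrreducibleCloseds.map j hj.continuous) Z
  have hclosed : IsClosed (Subtype.val ⁻¹' PrimeSpectrum.zeroLocus (q.asIdeal : Set R) : Set Yp) :=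
    (PrimeSpectrum.isClosed_zeroLocus _).preimage continuous_subtype_val
  have hlt : ∀ Z, TopologicalSpace.IrreducibleCloseds.map j hj.continuous Z < top := by
    intro Z
    refine lt_of_le_of_ne (fun _ _ => Set.mem_univ _) fun h => ?_
    have hp' : p' ∈ (TopologicalSpace.IrreducibleCloseds.map j hj.continuous Z : Set Yp) := by
      rw [h]; exact Set.mem_univ _
    have hle : (TopologicalSpace.IrreducibleCloseds.map j hj.continuous Z : Set Yp) ⊆
        Subtype.val ⁻¹' PrimeSpectrum.zeroLocus (q.asIdeal : Set R) := by
      rw [TopologicalSpace.IrreducibleCloseds.coe_map]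
      refine closure_minimal ?_ hclosed
      rintro _ ⟨z, _, rfl⟩
      exact z.2.1
    exact absurd (hle hp') (not_le_of_gt hpq)
  have hΦ : StrictMono Φ := by
    intro Z W hZW
    induction W using WithTop.recTopCoe with
    | top =>
      lift Z to TopologicalSpace.IrreducibleCloseds Yq using hZW.ne
      exact hlt Z
    | coe W =>
      lift Z to TopologicalSpace.IrreducibleCloseds Yq using (hZW.trans (WithTop.coe_lt_top W)).ne
      exact TopologicalSpace.IrreducibleCloseds.map_strictMono_of_isInducing hj
        (WithTop.coe_lt_coe.mp hZW)
  have := Order.krullDim_le_of_strictMono Φ hΦ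
  rwa [Order.krullDim_WithTop] at this

/-- The vanishing ideal of `Z` is a prime and an intersection of members of `X`, so the basic set
contains it. -/
theorem IsBasicSet.exists_generic (hX : IsBasicSet X) {Z : Set X} (hZ : IsClosed Z)
    (hZ' : IsIrreducible Z) : ∃ z ∈ Z, ∀ y ∈ Z, z ≤ y := by
  have hirr : IsIrreducible (Subtype.val '' Z) := hZ'.image _ continuous_subtype_val.continuousOn
  let p : PrimeSpectrum R :=
    ⟨_, PrimeSpectrum.isIrreducible_iff_vanishingIdeal_isPrime.mp hirr⟩
  have hp : p ∈ X := hX.2 p ⟨Subtype.val '' Z, by simp, rfl⟩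
  refine ⟨⟨p, hp⟩, ?_, fun y hy => ?_⟩
  · rw [← hZ.closure_eq, closure_subtype, ← PrimeSpectrum.zeroLocus_vanishingIdeal_eq_closure]
    exact fun _ h => h
  · change (p : PrimeSpectrum R).asIdeal ≤ (y : PrimeSpectrum R).asIdeal
    exact fun r hr => (PrimeSpectrum.mem_vanishingIdeal _ _).mp hr y ⟨y, hy, rfl⟩

/-- A closed subset of a basic set has finitely many minimal members. -/
theorem IsBasicSet.finite_minimal (hX : IsBasicSet X) {W : Set X} (hW : IsClosed W) :
    {q | Minimal (· ∈ W) q}.Finite := by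
  have := hX.1
  obtain ⟨S, hS, hcl, hirr, rfl⟩ :=
    TopologicalSpace.NoetherianSpace.exists_finite_set_isClosed_irreducible hW
  -- A minimal member of `W` is the generic point of each of the finitely many irreducible pieces
  -- containing it.
  refine (hS.biUnion (t := fun Z => {z | z ∈ Z ∧ ∀ y ∈ Z, z ≤ y}) fun Z _ =>
    Set.Subsingleton.finite fun x hx y hy => le_antisymm (hx.2 y hy.1) (hy.2 x hx.1)).subset ?_
  intro q hq
  obtain ⟨Z, hZ, hqZ⟩ := hq.prop
  obtain ⟨z, hz, hzZ⟩ := hX.exists_generic (hcl Z hZ) (hirr Z hZ)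
  have : q = z := le_antisymm (hq.le_of_le ⟨Z, hZ, hz⟩ (hzZ q hqZ)) (hzZ q hqZ)
  exact Set.mem_biUnion hZ ⟨hqZ, this ▸ hzZ⟩

end BasicSet

/-! ### The finite exceptional set and the conclusion -/

/-- A dual tuple with denominator `s` works at every prime of `basicOpen s`. -/
theorem isOpen_setOf_hasSplit {R S M N : Type*} [CommRing R] [Ring S] [Algebra R S]
    [AddCommGroup M] [Module R M] [Module Sᵐᵒᵖ M] [IsScalarTower R Sᵐᵒᵖ M]
    [AddCommGroup N] [Module R N] [Module Sᵐᵒᵖ N] [IsScalarTower R Sᵐᵒᵖ N]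
    (k : ℕ) (F : Submodule R (M →ₗ[Sᵐᵒᵖ] N)) :
    IsOpen {p : PrimeSpectrum R | HasSplit p.asIdeal.primeCompl k F} := by
  refine isOpen_iff_forall_mem_open.mpr ?_
  rintro p ⟨h, hF, s, hs, hg⟩
  exact ⟨PrimeSpectrum.basicOpen s, fun q hq => ⟨h, hF, s, hq, hg⟩,
    (PrimeSpectrum.basicOpen s).2, hs⟩

/-- A generator of a `(t, X, X)`-split map can be removed, if `X` is a basic set. -/
theorem IsSplitOn.exists_remove_generator {R S M N : Type*} [CommRing R] [Ring S] [Algebra R S]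
    [Module.Finite R S]
    [AddCommGroup M] [Module R M] [Module Sᵐᵒᵖ M] [IsScalarTower R Sᵐᵒᵖ M]
    [AddCommGroup N] [Module R N] [Module Sᵐᵒᵖ N] [IsScalarTower R Sᵐᵒᵖ N]
    [Module.FinitePresentation Sᵐᵒᵖ N] {n t : ℕ} {X : Set (PrimeSpectrum R)} (hX : IsBasicSet X)
    {f : Fin (n + 1) → (M →ₗ[Sᵐᵒᵖ] N)} (hf : IsSplitOn t X X f) :
    ∃ f' : Fin n → (M →ₗ[Sᵐᵒᵖ] N),
      (∀ i, f' i ∈ Submodule.span R (Set.range f)) ∧ IsSplitOn t X X f' := by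
  have : Module.Finite R Sᵐᵒᵖ := Module.Finite.equiv (MulOpposite.opLinearEquiv R)
  have : Module.Finite R N := Module.Finite.trans Sᵐᵒᵖ N
  set F := Submodule.span R (Set.range f)
  have hd : ∀ q ∈ X, ∃ d : ℕ∞, dimAt X q = d := by
    intro q hq
    let q' : ↥(PrimeSpectrum.zeroLocus (q.asIdeal : Set R) ∩ X) := ⟨q, fun _ h => h, hq⟩
    have hne : dimAt X q ≠ ⊥ := Order.krullDim_ne_bot_iff.mpr
      ⟨⟨closure {q'}, isIrreducible_singleton.closure, isClosed_closure⟩⟩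
    obtain ⟨d, hd⟩ := WithBot.ne_bot_iff_exists.mp hne
    exact ⟨d, hd.symm⟩
  choose! d hd using hd
  have hsplit : ∀ (m : ℕ) (g : Fin m → (M →ₗ[Sᵐᵒᵖ] N)), ∀ q ∈ X, IsSplitAt t X q g ↔
      min (m : ℕ∞) (t + d q) ≤ delta q (Submodule.span R (Set.range g)) := by
    intro m g q hq
    rw [IsSplitAt, hd q hq]
    norm_cast
  -- The cap is `n`, the size of the new tuple, while `f` has `n + 1` members; this keeps `k q`
  -- finite even in infinite dimension.
  have hk : ∀ q, ∃ k : ℕ, (k : ℕ∞) = min (n : ℕ∞) (t + d q) := fun q =>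
    ENat.ne_top_iff_exists.mp (ne_top_of_le_ne_top (ENat.natCast_ne_top n) (min_le_left _ _))
  choose k hk using hk
  have hkn : ∀ q, k q ≤ n := fun q => by
    have := (hk q).trans_le (min_le_left _ _)
    exact_mod_cast this
  have hkd : ∀ q, (k q : ℕ∞) ≤ t + d q := fun q => (hk q).trans_le (min_le_right _ _)
  have hfk : ∀ q ∈ X, HasSplit q.asIdeal.primeCompl (k q) F := by
    intro q hq
    refine natCast_le_delta_iff.mp (le_trans (le_min ?_ (hkd q)) ((hsplit _ f q hq).mp (hf q hq)))
    exact_mod_cast (hkn q).trans n.le_succ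
  let W : ℕ → Set X := fun l => {q | ¬ HasSplit (q : PrimeSpectrum R).asIdeal.primeCompl (l + 1) F}
  have hW : ∀ l, IsClosed (W l) := fun l =>
    ((isOpen_setOf_hasSplit (l + 1) F).preimage continuous_subtype_val).isClosed_compl
  -- Each such `q` is minimal in `W (k q)`: for `p < q` in `X` the dimension grows by at least one,
  -- so the bound `min (n + 1) (t + d p)` at `p` is at least `k q + 1`. Only the levels `l ≤ n`
  -- occur.
  have hΛ : {q : X | q ∈ W (k q)}.Finite := by
    refine ((Set.finite_Iic n).biUnion fun l _ => hX.finite_minimal (hW l)).subset ?_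
    intro q hq
    refine Set.mem_biUnion (hkn q) ⟨hq, fun p hp hpq => ?_⟩
    by_contra hqp
    have hlt : (p : PrimeSpectrum R) < q := lt_of_le_not_ge hpq hqp
    have hdim := dimAt_add_one_le p.2 q.2 hlt
    rw [hd _ p.2, hd _ q.2] at hdim
    have hdim : d q + 1 ≤ d p := by exact_mod_cast hdim
    refine hp (natCast_le_delta_iff.mp (le_trans (le_min ?_ ?_) ((hsplit _ f p p.2).mp (hf p p.2))))
    · exact_mod_cast Nat.succ_le_succ (hkn q)
    · push_cast
      calc (k q : ℕ∞) + 1 ≤ t + d q + 1 := by gcongr; exact hkd q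
        _ ≤ t + d p := by rw [add_assoc]; gcongr
  classical
  obtain ⟨f', hf'F, hf'Λ, hf'⟩ := SplitCapacity.exists_remove_generator f
    (hΛ.toFinset.image Subtype.val) k (fun p _ => hkn p) (by
      intro p hp
      obtain ⟨q, _, rfl⟩ := Finset.mem_image.mp hp
      exact hfk q q.2)
  refine ⟨f', hf'F, fun q hq => (hsplit n f' q hq).mpr ?_⟩
  rw [← hk, natCast_le_delta_iff]
  -- With a spare splitting, losing one is allowed; without it, `q` is among the finitely many
  -- primes where none is lost.
  by_cases hqΛ : HasSplit q.asIdeal.primeCompl (k q + 1) F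
  · exact hf' q _ hqΛ
  · exact hf'Λ q (Finset.mem_image.mpr ⟨⟨q, hq⟩, hΛ.mem_toFinset.mpr hqΛ, rfl⟩)

end SplitCapacity

theorem mainTheorem7 {R S M N : Type*} [CommRing R] [Ring S] [Algebra R S] [Module.Finite R S]
    [AddCommGroup M] [Module R M] [Module Sᵐᵒᵖ M] [IsScalarTower R Sᵐᵒᵖ M]
    [AddCommGroup N] [Module R N] [Module Sᵐᵒᵖ N] [IsScalarTower R Sᵐᵒᵖ N]
    [Module.FinitePresentation Sᵐᵒᵖ N]
    (n t : ℕ) (ht : 0 < t) (hn : t + 1 ≤ n)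
    (X : Set (PrimeSpectrum R)) (hXN : X ⊆ Module.support R N) (hX : SplitCapacity.IsBasicSet X)
    (f : Fin n → (M →ₗ[Sᵐᵒᵖ] N)) (hf : SplitCapacity.IsSplitOn t X X f) :
    ∃ f' : Fin (n - 1) → (M →ₗ[Sᵐᵒᵖ] N),
      (∀ i, f' i ∈ Submodule.span R (Set.range f)) ∧ SplitCapacity.IsSplitOn t X X f' := by
  obtain ⟨n, rfl⟩ : ∃ m, n = m + 1 := ⟨n - 1, by omega⟩
  exact hf.exists_remove_generator hX
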